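/- **Theorem.** For $n,k\ge 0$ let $B(n,k)$ be the number of Stirling permutations of order $n$ with exactly $k$ descents. Here a Stirling permutation of order $n$ is a word $w_1\cdots w_{2n}$ in which each of $1,\dots,n$ occurs exactly twice and every letter between the two occurrences of $a$ is larger than $a$, and a descent is an index $1\le i<2n$ with $w_i>w_{i+1}$. Let $T(z)=\sum_{n\ge1}n^{n-1}\frac{z^n}{n!}$ be the Cayley tree function, and put $w=\frac yx\exp\!\left(-\frac yx+(x-y)^2t\right)$. (a) $B(0,0)=1$ and $B(0,k)=0$ for $k\ge 1$. For all $n\ge1$ and $k\ge0$, with $B(n-1,-1)=0$, $$B(n,k)=(k+1)B(n-1,k)+(2n-k-1)B(n-1,k-1).$$ (b) Let $K$ be a field of characteristic $0$. Then $T(z)=z\,e^{T(z)}$ in $K[[z]]$. For every nonzero $x\in K$ (for instance $K=\mathbb Q(x)$ with $x$ an indeterminate), the following holds in the ring $K[[y,t]]$ of formal power series in the indeterminates $y$ and $t$: $$\sum_{n\ge0}\sum_{k=0}^{n}B(n,k)\,x^{2n-k}y^{k+1}\frac{t^n}{n!}=\frac{(x-y)\,T(w)}{1-T(w)}.$$ (c)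 Let $x,y,t\in\mathbb C$ satisfy $|y|<|x|$ and $\left|\frac yx e^{-y/x}\right|e^{|(x-y)^2t|}<e^{-1}$. Then the series $T(w)$ converges, $T(w)=w\,e^{T(w)}$, $T(w)\neq1$, and the identity in (b) holds as an identity of complex numbers, the series over $n$ on its left-hand side being absolutely convergent. -/

import Mathlib

/-- The set of Stirling `r`-permutations of order `n`: words in which each of the letters
`1, …, n` occurs exactly `r` times (and no other letter occurs), such that no letter standing
between two occurrences of a letter `a` is smaller than `a`. For `r = 2`, each letter between
the two occurrences of `a` is then larger than `a`. -/
def stirlingPermutations (r n : ℕ) : Set (List ℕ) :=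
  {w | (∀ a : ℕ, w.count a = if 1 ≤ a ∧ a ≤ n then r else 0) ∧
    ∀ a b : ℕ, List.Sublist [a, b, a] w → a ≤ b}

/-- The number of descents of a word: of pairs of adjacent letters `w_i, w_{i+1}` with
`w_i > w_{i+1}`. -/
def wordDescents (w : List ℕ) : ℕ :=
  (w.zip w.tail).countP (fun p => decide (p.2 < p.1))

/-- There are finitely many Stirling `r`-permutations of order `n`. -/
theorem stirlingPermutations_finite (r n : ℕ) : (stirlingPermutations r n).Finite := by
  rcases (stirlingPermutations r n).eq_empty_or_nonempty with h | ⟨w₀, h₀⟩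
  · rw [h]; exact Set.finite_empty
  · refine (w₀.permutations.toFinset.finite_toSet).subset ?_
    intro w hw
    simp only [List.coe_toFinset, Set.mem_ofPred_eq, List.mem_permutations]
    refine List.perm_iff_count.2 fun a => ?_
    rw [hw.1 a, h₀.1 a]

/-- `B^{(r)}(n, k)`: the number of Stirling `r`-permutations of order `n` with `k` descents. -/
noncomputable def stirlingDescentCount (r n k : ℕ) : ℕ :=
  {w ∈ stirlingPermutations r n | wordDescents w = k}.ncard

/-- `B(n, k) = B^{(2)}(n, k)`. -/
noncomputable abbrev stirlingB (n k : ℕ) : ℕ := stirlingDescentCount 2 n k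

/-- The coefficient `n^{n-1} / n!` of the tree series for `n ≥ 1`, and `0` for `n = 0`. -/
def treeCoeff (K : Type*) [Field K] (n : ℕ) : K :=
  if n = 0 then 0 else (n : K) ^ (n - 1) / (n.factorial : K)

/-- The Cayley tree function as a formal power series, `T(z) = ∑_{n ≥ 1} n^{n-1} z^n / n!`. -/
def treeSeries (K : Type*) [Field K] : PowerSeries K :=
  PowerSeries.mk (treeCoeff K)

/-- The Cayley tree function as the sum of its power series, `∑_{n ≥ 1} n^{n-1} z^n / n!`. -/
noncomputable def treeFun (z : ℂ) : ℂ := ∑' n : ℕ, treeCoeff ℂ n * z ^ n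

/-! In `K⟦y, t⟧` the variable `y` is `X 0` and the variable `t` is `X 1`. -/

/-- The formal power series `∑_n ∑_{k ≤ n} B(n, k) x^{2n-k} y^{k+1} t^n / n!` in `K⟦y, t⟧`,
given by its coefficients: only the term of index `n` contributes to the monomials `y^j t^n`. -/
noncomputable def stirlingSeries {K : Type*} [Field K] (x : K) : MvPowerSeries (Fin 2) K :=
  fun m => ∑ k ∈ Finset.range (m 1 + 1),
    if m 0 = k + 1 then
      (stirlingB (m 1) k : K) * x ^ (2 * m 1 - k) / ((m 1).factorial : K)
    else 0

/-- The formal power series `y / x` in `K⟦y, t⟧`. -/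
noncomputable def ratioSeries {K : Type*} [Field K] (x : K) : MvPowerSeries (Fin 2) K :=
  MvPowerSeries.C x⁻¹ * MvPowerSeries.X 0

/-- The formal power series `x - y` in `K⟦y, t⟧`. -/
noncomputable def diffSeries {K : Type*} [Field K] (x : K) : MvPowerSeries (Fin 2) K :=
  MvPowerSeries.C x - MvPowerSeries.X 0

/-- The formal power series `w = (y/x) exp(-y/x + (x-y)² t)` in `K⟦y, t⟧`. -/
noncomputable def wSeries {K : Type*} [Field K] [CharZero K] (x : K) :
    MvPowerSeries (Fin 2) K :=
  ratioSeries x *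
    (PowerSeries.exp K).subst
      (-ratioSeries x + diffSeries x ^ 2 * MvPowerSeries.X 1 : MvPowerSeries (Fin 2) K)

/-- The complex number `w = (y/x) exp(-y/x + (x-y)² t)`. -/
noncomputable def wNumber (x y t : ℂ) : ℂ :=
  y / x * Complex.exp (-(y / x) + (x - y) ^ 2 * t)

/-! Recurrence. In a Stirling permutation of order n+1 the two copies of the maximum n+1 are
adjacent, and deleting them leaves one of order n. So each arises exactly once by inserting the pair
at one of the 2n+1 positions of a smaller word. Insertion at the end or inside a descent keeps the
number of descents; any other insertion adds one. A word with d descents therefore has d+1 neutral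
positions and 2n-d positions that create a descent.

Formal identity. The recurrence says that the generating function F satisfies the first-order linear
equation F_t = x²yF_y + xy(2tF_t + F - yF_y). Every series (x-y)f(w) solves the same equation, and a
solution is determined by its part at t = 0. There F equals y, which with z = y/x asks for
f(ze^{-z}) = z/(1-z). The solution is f = ∑ nⁿzⁿ/n! = T/(1-T). Both this and T(ze^{-z}) = z reduce
to the fact that the N-th difference of r^{N-1} is 0 and that of r^N is N!.

Numerical identity. This is proved without the formal one. With P_n(z) = ∑_k B(n,k)z^{k+1}, the
recurrence gives P_n(z) = (1-z)^{2n+1} ∑_m m^{m+n}(ze^{-z})^m/m!. Multiplying by x^{2n+1}tⁿ/n!,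
summing over n and exchanging the absolutely convergent sums turns the powers of m into exponentials
that combine to w^m. The functional equations of T hold near 0 by rearrangement of series, and then
on larger domains by the identity theorem. -/

/-! ### Descents after insertion of a pair of maxima. -/

theorem wordDescents_cons_cons (a b : ℕ) (l : List ℕ) :
    wordDescents (a :: b :: l) = (if b < a then 1 else 0) + wordDescents (b :: l) := by
  simp [wordDescents, List.countP_cons, add_comm]

theorem wordDescents_singleton (a : ℕ) : wordDescents [a] = 0 := by simp [wordDescents]

theorem wordDescents_nil : wordDescents [] = 0 := by simp [wordDescents]

/-- The word `u` with two adjacent copies of `N` inserted at position `i`. -/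
def insertPair (N : ℕ) (u : List ℕ) (i : ℕ) : List ℕ := u.take i ++ N :: N :: u.drop i

theorem wordDescents_insertPair_zero {N a : ℕ} (l : List ℕ) (h : a < N) :
    wordDescents (insertPair N (a :: l) 0) = wordDescents (a :: l) + 1 := by
  simp [insertPair, wordDescents_cons_cons, h, add_comm]

theorem wordDescents_insertPair_one {N a b : ℕ} (l : List ℕ) (ha : a < N) (hb : b < N) :
    wordDescents (insertPair N (a :: b :: l) 1) = wordDescents (b :: l) + 1 := by
  simp [insertPair, wordDescents_cons_cons, ha.not_gt, hb, add_comm]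

theorem wordDescents_insertPair_add_two (N a b : ℕ) (l : List ℕ) (i : ℕ) :
    wordDescents (insertPair N (a :: b :: l) (i + 2)) =
      (if b < a then 1 else 0) + wordDescents (insertPair N (b :: l) (i + 1)) := by
  simp [insertPair, wordDescents_cons_cons]

/-- Inserting a pair of new maxima either keeps the number of descents or increases it by one. -/
theorem wordDescents_insertPair_eq_or {N : ℕ} (u : List ℕ) (hu : ∀ a ∈ u, a < N) (i : ℕ)
    (hi : i ≤ u.length) :
    wordDescents (insertPair N u i) = wordDescents u ∨
      wordDescents (insertPair N u i) = wordDescents u + 1 := by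
  induction u generalizing i with
  | nil => left; simp [insertPair, wordDescents_cons_cons, wordDescents_nil, wordDescents_singleton]
  | cons a l ih =>
    rcases i with _ | i
    · right; exact wordDescents_insertPair_zero l (hu a (by simp))
    rcases l with _ | ⟨b, l⟩
    · left
      have := hu a (by simp)
      simp [insertPair, wordDescents_cons_cons, wordDescents_singleton, this.le]
    rcases i with _ | i
    · rw [zero_add, wordDescents_insertPair_one l (hu a (by simp)) (hu b (by simp)),
        wordDescents_cons_cons]
      split_ifs <;> omega
    · rw [wordDescents_insertPair_add_two, wordDescents_cons_cons]
      have := ih (fun c hc => hu c (by simp [List.mem_cons.1 hc])) (i + 1) (by simpa using hi)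
      omega

/-- The number of positions at which the insertion of a pair of new maxima creates no descent. -/
theorem card_wordDescents_insertPair_eq {N : ℕ} (u : List ℕ) (hu : ∀ a ∈ u, a < N) :
    ((Finset.range (u.length + 1)).filter
      fun i => wordDescents (insertPair N u i) = wordDescents u).card = wordDescents u + 1 := by
  rw [Finset.card_filter]
  induction u with
  | nil => simp [insertPair, wordDescents_cons_cons, wordDescents_nil, wordDescents_singleton]
  | cons a l ih =>
    have ha := hu a (by simp)
    rcases l with _ | ⟨b, l⟩
    · rw [List.length_singleton, Finset.sum_range_succ, Finset.sum_range_one]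
      simp [insertPair, wordDescents_cons_cons, wordDescents_singleton, ha.le, ha]
    have hb := hu b (by simp)
    have ih' := ih (fun c hc => hu c (by simp [List.mem_cons.1 hc]))
    rw [List.length_cons, Finset.sum_range_succ'] at ih' ⊢
    rw [List.length_cons, Finset.sum_range_succ']
    simp only [wordDescents_insertPair_zero _ ha, wordDescents_insertPair_zero _ hb, zero_add,
      wordDescents_insertPair_one _ ha hb, wordDescents_insertPair_add_two, add_assoc,
      Nat.reduceAdd] at ih' ⊢
    simp only [wordDescents_cons_cons a b, add_right_inj] at ih' ⊢
    split_ifs at ih' ⊢ <;> simp_all <;> omega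

/-- A word with d descents has d+1 neutral positions among its `u.length + 1`; each of the others
creates exactly one descent. For d = k-1 these others number `u.length + 1 - k`. -/
theorem card_wordDescents_insertPair {N : ℕ} (u : List ℕ) (hu : ∀ a ∈ u, a < N) (k : ℕ) :
    (((Finset.range (u.length + 1)).filter
      fun i => wordDescents (insertPair N u i) = k).card : ℤ) =
      (if wordDescents u = k then (k : ℤ) + 1 else 0) +
        (if wordDescents u + 1 = k then (u.length : ℤ) + 1 - k else 0) := by
  have h := card_wordDescents_insertPair_eq u hu
  by_cases h0 : wordDescents u = k
  · subst h0; rw [h]; simp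
  rw [if_neg h0, zero_add]
  split_ifs with h1
  · have h2 := Finset.card_filter_add_card_filter_not (s := Finset.range (u.length + 1))
      (fun i => wordDescents (insertPair N u i) = wordDescents u)
    rw [h, Finset.card_range] at h2
    have h3 : (Finset.range (u.length + 1)).filter
        (fun i => ¬ wordDescents (insertPair N u i) = wordDescents u) =
        (Finset.range (u.length + 1)).filter (fun i => wordDescents (insertPair N u i) = k) := by
      refine Finset.filter_congr fun i hi => ?_
      have := wordDescents_insertPair_eq_or u hu i (by simpa [Nat.lt_succ_iff] using hi)
      omega
    rw [h3] at h2
    omega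
  · rw [Nat.cast_eq_zero, Finset.card_eq_zero, Finset.filter_eq_empty_iff]
    intro i hi
    have := wordDescents_insertPair_eq_or u hu i (by simpa [Nat.lt_succ_iff] using hi)
    omega

/-! ### Removal of the largest letter and the recurrence for B(n, k). -/

theorem lt_of_mem_stirlingPermutations {r n : ℕ} {u : List ℕ} (hu : u ∈ stirlingPermutations r n)
    {a : ℕ} (ha : a ∈ u) : a < n + 1 := by
  have h := hu.1 a
  have h' := List.count_pos_iff.2 ha
  split_ifs at h <;> omega

theorem length_of_mem_stirlingPermutations {n : ℕ} {u : List ℕ}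
    (hu : u ∈ stirlingPermutations 2 n) : u.length = 2 * n := by
  have h : u.toFinset = Finset.Icc 1 n := by
    ext a
    rw [List.mem_toFinset, ← List.count_pos_iff, hu.1 a, Finset.mem_Icc]
    split_ifs <;> simp_all
  rw [← List.sum_toFinset_count_eq_length, h, Finset.sum_congr rfl (g := fun _ => 2)]
  · simp [mul_comm]
  · intro a ha
    rw [hu.1 a, if_pos (Finset.mem_Icc.1 ha)]

theorem not_sublist_of_notMem {N b : ℕ} (hb : b ≠ N) {p q : List ℕ} (hp : N ∉ p) (hq : N ∉ q) :
    ¬ List.Sublist [N, b, N] (p ++ N :: N :: q) := by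
  intro h
  obtain ⟨l₁, l₂, hl, h₁, h₂⟩ := List.sublist_append_iff.1 h
  rcases l₁ with _ | ⟨c, l₁⟩
  · rw [List.nil_append] at hl
    subst hl
    rw [List.cons_sublist_cons] at h₂
    have h₃ : List.Sublist [b, N] q := by
      cases h₂ with
      | cons _ h => exact h
      | cons_cons _ h => exact absurd rfl hb
    exact hq (h₃.subset (by simp))
  · simp only [List.cons_append, List.cons.injEq] at hl
    exact hp (h₁.subset (by simp [hl.1]))

theorem filter_insertPair {N : ℕ} {u : List ℕ} (hu : N ∉ u) (i : ℕ) :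
    (insertPair N u i).filter (fun a => decide (a ≠ N)) = u := by
  have : ∀ l : List ℕ, N ∉ l → l.filter (fun a => decide (a ≠ N)) = l := fun l hl =>
    List.filter_eq_self.2 fun a ha => by
      simp only [decide_eq_true_eq]; rintro rfl; exact hl ha
  rw [insertPair, List.filter_append, this _ (fun h => hu (List.mem_of_mem_take h)),
    List.filter_cons_of_neg (by simp), List.filter_cons_of_neg (by simp),
    this _ (fun h => hu (List.mem_of_mem_drop h)), List.take_append_drop]

theorem idxOf_insertPair {N : ℕ} {u : List ℕ} (hu : N ∉ u) {i : ℕ} (hi : i ≤ u.length) :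
    (insertPair N u i).idxOf N = i := by
  rw [insertPair, List.idxOf_append_of_notMem (fun h => hu (List.mem_of_mem_take h))]
  simp [hi]

theorem insertPair_mem_stirlingPermutations {n : ℕ} {u : List ℕ}
    (hu : u ∈ stirlingPermutations 2 n) (i : ℕ) :
    insertPair (n + 1) u i ∈ stirlingPermutations 2 (n + 1) := by
  have hN : n + 1 ∉ u := fun h => lt_irrefl _ (lt_of_mem_stirlingPermutations hu h)
  have hc : ∀ a, (insertPair (n + 1) u i).count a = u.count a + if a = n + 1 then 2 else 0 := by
    intro a
    have h1 : u.count a = (u.take i).count a + (u.drop i).count a := by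
      rw [← List.count_append, List.take_append_drop]
    by_cases h : a = n + 1
    · subst h; simp [insertPair, h1]; omega
    · simp [insertPair, h, h1, Ne.symm h]
  have hcount : ∀ a, (insertPair (n + 1) u i).count a = if 1 ≤ a ∧ a ≤ n + 1 then 2 else 0 := by
    intro a
    rw [hc, hu.1 a]
    split_ifs <;> omega
  refine ⟨hcount, fun a b hab => ?_⟩
  have hle : ∀ c ∈ [a, b, a], c ≤ n + 1 := by
    intro c hc
    have h := List.count_pos_iff.2 (hab.subset hc)
    rw [hcount c] at h
    split_ifs at h <;> omega
  by_cases hb : b = n + 1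
  · subst hb; exact hle a (by simp)
  by_cases ha : a = n + 1
  · subst ha
    exact absurd hab (not_sublist_of_notMem hb (fun h => hN (List.mem_of_mem_take h))
      (fun h => hN (List.mem_of_mem_drop h)))
  · have := hab.filter (fun c => decide (c ≠ n + 1))
    rw [filter_insertPair hN] at this
    exact hu.2 a b (by simpa [ha, hb] using this)

theorem exists_insertPair_eq {n : ℕ} {v : List ℕ} (hv : v ∈ stirlingPermutations 2 (n + 1)) :
    ∃ u ∈ stirlingPermutations 2 n, ∃ i ≤ u.length, insertPair (n + 1) u i = v := by
  have hcv : v.count (n + 1) = 2 := by simp [hv.1]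
  obtain ⟨p, s, rfl, hp⟩ := List.eq_append_cons_of_mem
    (List.count_pos_iff.1 (by omega : 0 < v.count (n + 1)))
  have hs : s.count (n + 1) = 1 := by
    rw [List.count_append, List.count_cons_self, List.count_eq_zero_of_not_mem hp] at hcv
    omega
  obtain ⟨m, c, rfl, hm⟩ := List.eq_append_cons_of_mem
    (List.count_pos_iff.1 (by omega : 0 < s.count (n + 1)))
  -- A letter between the two copies of the maximum n+1 would be at least n+1, hence equal to it,
  -- which would be a third copy.
  have hm' : m = [] := by
    rcases m with _ | ⟨d, m⟩
    · rfl
    have h1 : n + 1 ≤ d := hv.2 (n + 1) d <| by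
      refine List.Sublist.trans ?_ (List.sublist_append_right p _)
      simp
    have h2 := lt_of_mem_stirlingPermutations hv (a := d) (by simp)
    exact absurd (by simp; omega) hm
  subst hm'
  simp only [List.nil_append] at hv hs ⊢
  refine ⟨p ++ c, ⟨fun a => ?_, fun a b hab => hv.2 a b (hab.trans ?_)⟩, p.length, by simp, by
    simp [insertPair]⟩
  · have h := hv.1 a
    have hp' := List.count_eq_zero_of_not_mem hp
    have hc' : c.count (n + 1) = 0 := by simpa using hs
    by_cases ha : a = n + 1
    · subst ha; simp [hp', hc']
    · simp only [List.count_append, List.count_cons_of_ne (Ne.symm ha)] at h ⊢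
      rw [h]
      split_ifs <;> omega
  · exact List.Sublist.append_left (((List.Sublist.refl c).cons _).cons _) p

theorem stirlingDescentCount_eq_card (r n k : ℕ) :
    stirlingDescentCount r n k =
      ((stirlingPermutations_finite r n).toFinset.filter fun w => wordDescents w = k).card := by
  rw [stirlingDescentCount, ← Set.ncard_coe_finset]
  congr 1
  ext w
  simp

theorem stirlingB_succ_eq_card (n k : ℕ) :
    stirlingB (n + 1) k =
      (((stirlingPermutations_finite 2 n).toFinset ×ˢ Finset.range (2 * n + 1)).filter
        fun p => wordDescents (insertPair (n + 1) p.1 p.2) = k).card := by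
  have hN : ∀ u ∈ stirlingPermutations 2 n, n + 1 ∉ u := fun u hu h =>
    lt_irrefl _ (lt_of_mem_stirlingPermutations hu h)
  rw [stirlingB, stirlingDescentCount_eq_card]
  symm
  refine Finset.card_bij (fun p _ => insertPair (n + 1) p.1 p.2) ?_ ?_ ?_
  · rintro ⟨u, i⟩ h
    simp only [Finset.mem_filter, Finset.mem_product, Set.Finite.mem_toFinset] at h ⊢
    exact ⟨insertPair_mem_stirlingPermutations h.1.1 i, h.2⟩
  · rintro ⟨u, i⟩ h ⟨u', i'⟩ h' e
    simp only [Finset.mem_filter, Finset.mem_product, Set.Finite.mem_toFinset,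
      Finset.mem_range] at h h' e
    have h1 : u = u' := by
      rw [← filter_insertPair (hN u h.1.1) i, e, filter_insertPair (hN u' h'.1.1)]
    have l1 := length_of_mem_stirlingPermutations h.1.1
    have l2 := length_of_mem_stirlingPermutations h'.1.1
    have h2 : i = i' := by
      rw [← idxOf_insertPair (hN u h.1.1) (i := i) (by omega), e,
        idxOf_insertPair (hN u' h'.1.1) (by omega)]
    rw [h1, h2]
  · intro v hv
    simp only [Finset.mem_filter, Set.Finite.mem_toFinset] at hv
    obtain ⟨u, hu, i, hi, rfl⟩ := exists_insertPair_eq hv.1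
    refine ⟨(u, i), ?_, rfl⟩
    rw [length_of_mem_stirlingPermutations hu] at hi
    simp only [Finset.mem_filter, Finset.mem_product, Set.Finite.mem_toFinset, Finset.mem_range]
    exact ⟨⟨hu, by omega⟩, hv.2⟩

/-- Counting words with `wordDescents w + 1 = k` instead of writing B(n, k-1) covers k = 0 as well,
where there are none. -/
theorem stirlingB_succ_eq_sum (n k : ℕ) :
    (stirlingB (n + 1) k : ℤ) = ((k : ℤ) + 1) * stirlingB n k + (2 * (n : ℤ) + 1 - k) *
      ((stirlingPermutations_finite 2 n).toFinset.filter fun w => wordDescents w + 1 = k).card := by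
  rw [stirlingB_succ_eq_card, Finset.card_filter, Finset.sum_product, stirlingB,
    stirlingDescentCount_eq_card, Nat.cast_sum]
  have : ∀ u ∈ (stirlingPermutations_finite 2 n).toFinset,
      ((∑ i ∈ Finset.range (2 * n + 1),
        if wordDescents (insertPair (n + 1) u i) = k then 1 else 0 : ℕ) : ℤ) =
      (if wordDescents u = k then (k : ℤ) + 1 else 0) +
        (if wordDescents u + 1 = k then 2 * (n : ℤ) + 1 - k else 0) := by
    intro u hu
    rw [Set.Finite.mem_toFinset] at hu
    have h := card_wordDescents_insertPair u (fun a ha => lt_of_mem_stirlingPermutations hu ha) k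
    rw [length_of_mem_stirlingPermutations hu, Finset.card_filter] at h
    rw [h]
    push_cast
    rfl
  rw [Finset.sum_congr rfl this, Finset.sum_add_distrib, ← Finset.sum_filter, ← Finset.sum_filter,
    Finset.sum_const, Finset.sum_const, nsmul_eq_mul, nsmul_eq_mul]
  ring

theorem stirlingB_succ_zero (n : ℕ) : stirlingB (n + 1) 0 = stirlingB n 0 := by
  have := stirlingB_succ_eq_sum n 0
  simp at this
  exact_mod_cast this

theorem stirlingB_succ_succ (n k : ℕ) :
    (stirlingB (n + 1) (k + 1) : ℤ) =
      ((k : ℤ) + 2) * stirlingB n (k + 1) + (2 * (n : ℤ) - k) * stirlingB n k := by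
  rw [stirlingB_succ_eq_sum, stirlingB, stirlingB, stirlingDescentCount_eq_card,
    stirlingDescentCount_eq_card]
  simp only [add_left_inj]
  push_cast
  ring

theorem stirlingB_zero (k : ℕ) : stirlingB 0 k = if k = 0 then 1 else 0 := by
  have h : (stirlingPermutations_finite 2 0).toFinset = {[]} := by
    ext w
    rw [Set.Finite.mem_toFinset, Finset.mem_singleton]
    constructor
    · intro hw
      exact List.length_eq_zero_iff.1 (length_of_mem_stirlingPermutations hw)
    · rintro rfl
      refine ⟨fun a => ?_, fun a b h => ?_⟩
      · rw [if_neg (by omega)]; rfl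
      · simp at h
  rw [stirlingB, stirlingDescentCount_eq_card, h, Finset.filter_singleton, wordDescents_nil]
  rcases k with _ | k <;> simp

theorem stirlingB_eq_zero_of_lt {n k : ℕ} (h : n < k) : stirlingB n k = 0 := by
  induction n generalizing k with
  | zero => rw [stirlingB_zero, if_neg (by omega)]
  | succ n ih =>
    obtain ⟨k, rfl⟩ : ∃ j, k = j + 1 := ⟨k - 1, by omega⟩
    have := stirlingB_succ_succ n k
    rw [ih (by omega : n < k + 1), ih (by omega : n < k)] at this
    simpa using this

/-! ### Tree coefficients and iterated differences. -/

/-- The alternating sums of the coefficients of `∑ d^j d^{d-1} z^d / d!` that arise from the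
substitution of `z e^{-z}` are iterated differences of powers. -/
theorem sum_treeCoeff_mul {K : Type*} [Field K] [CharZero K] {N j : ℕ}
    (h : N - 1 + j ≠ 0) :
    ∑ d ∈ Finset.range (N + 1),
        (d : K) ^ j * treeCoeff K d * ((-(d : K)) ^ (N - d) / ((N - d).factorial : K)) =
      ((fwdDiff 1)^[N] (fun r : K => r ^ (N - 1 + j)) 0) / (N.factorial : K) := by
  rw [fwdDiff_iter_eq_sum_shift, Finset.sum_div]
  refine Finset.sum_congr rfl fun d hd => ?_
  have hdN : d ≤ N := Nat.lt_succ_iff.1 (Finset.mem_range.1 hd)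
  rcases Nat.eq_zero_or_pos d with rfl | hd0
  -- The term d = 0 vanishes on the left by the convention for `treeCoeff`, on the right because the
  -- exponent is nonzero.
  · simp [treeCoeff, zero_pow h]
  have e1 : (d : K) ^ (N - 1 + j) = (d : K) ^ j * (d : K) ^ (d - 1) * (d : K) ^ (N - d) := by
    rw [← pow_add, ← pow_add]; congr 1; omega
  have e2 : (N.choose d : K) = N.factorial / (d.factorial * (N - d).factorial) :=
    Nat.cast_choose K hdN
  have h1 : (d.factorial : K) ≠ 0 := by exact_mod_cast d.factorial_ne_zero
  have h2 : ((N - d).factorial : K) ≠ 0 := by exact_mod_cast (N - d).factorial_ne_zero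
  have h3 : (N.factorial : K) ≠ 0 := by exact_mod_cast N.factorial_ne_zero
  rw [treeCoeff, if_neg hd0.ne', neg_pow]
  simp only [nsmul_eq_mul, mul_one, zero_add, e1, zsmul_eq_mul, Int.cast_mul, Int.cast_pow,
    Int.cast_neg, Int.cast_one, Int.cast_natCast, e2]
  field_simp

/-- These are the coefficients of T(ze^{-z}). For N ≥ 2 they are N-th differences of a power of
degree N-1, hence zero. -/
theorem sum_treeCoeff {K : Type*} [Field K] [CharZero K] (N : ℕ) :
    ∑ d ∈ Finset.range (N + 1), treeCoeff K d * ((-(d : K)) ^ (N - d) / ((N - d).factorial : K)) =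
      if N = 1 then 1 else 0 := by
  rcases N with _ | _ | N
  · simp [treeCoeff]
  · simp [treeCoeff, Finset.sum_range_succ]
  · have := sum_treeCoeff_mul (K := K) (N := N + 1 + 1) (j := 0) (by omega)
    rw [fwdDiff_iter_pow_eq_zero_of_lt (by omega)] at this
    simpa using this

/-- The extra factor d raises the degree to N, and the N-th difference becomes N!; the values are
the coefficients of z/(1-z). -/
theorem sum_mul_treeCoeff {K : Type*} [Field K] [CharZero K] (N : ℕ) :
    ∑ d ∈ Finset.range (N + 1),
        (d : K) * treeCoeff K d * ((-(d : K)) ^ (N - d) / ((N - d).factorial : K)) =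
      if N = 0 then 0 else 1 := by
  rcases N with _ | N
  · simp [treeCoeff]
  · have := sum_treeCoeff_mul (K := K) (N := N + 1) (j := 1) (by omega)
    rw [Nat.add_sub_cancel, fwdDiff_iter_eq_factorial] at this
    have h3 : ((N + 1).factorial : K) ≠ 0 := by exact_mod_cast (N + 1).factorial_ne_zero
    simpa [h3] using this

/-! ### The tree series as compositional inverse of ze^{-z}. -/

namespace PowerSeries

variable {K : Type*} [Field K] [CharZero K]

/-- The power series `z e^{-z}`. -/
noncomputable def mulExpNeg (K : Type*) [Field K] [CharZero K] : PowerSeries K :=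
  X * evalNegHom (exp K)

theorem constantCoeff_mulExpNeg : constantCoeff (mulExpNeg K) = 0 := by simp [mulExpNeg]

theorem hasSubst_mulExpNeg : HasSubst (mulExpNeg K) :=
  HasSubst.of_constantCoeff_zero' constantCoeff_mulExpNeg

theorem coeff_mulExpNeg_pow (d N : ℕ) :
    coeff N (mulExpNeg K ^ d) =
      if d ≤ N then (-(d : K)) ^ (N - d) / ((N - d).factorial : K) else 0 := by
  rw [mulExpNeg, mul_pow, ← map_pow, exp_pow_eq_rescale_exp, coeff_X_pow_mul', evalNegHom]
  split_ifs with h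
  · rw [coeff_rescale, coeff_rescale, coeff_exp, neg_pow (d : K)]
    simp [mul_assoc, div_eq_mul_inv]
  · rfl

theorem coeff_subst_mulExpNeg (F : PowerSeries K) (N : ℕ) :
    coeff N (F.subst (mulExpNeg K)) = ∑ d ∈ Finset.range (N + 1),
      coeff d F * ((-(d : K)) ^ (N - d) / ((N - d).factorial : K)) := by
  rw [coeff_subst' hasSubst_mulExpNeg, finsum_eq_sum_of_support_subset (s := Finset.range (N + 1))]
  · refine Finset.sum_congr rfl fun d hd => ?_
    rw [coeff_mulExpNeg_pow, if_pos (Nat.lt_succ_iff.1 (Finset.mem_range.1 hd)), smul_eq_mul]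
  · intro d hd
    rw [Function.mem_support, coeff_mulExpNeg_pow] at hd
    simp only [Finset.coe_range, Set.mem_Iio]
    by_contra h
    exact hd (by rw [if_neg (by omega), smul_zero])

theorem treeSeries_subst_mulExpNeg : (treeSeries K).subst (mulExpNeg K) = (X : PowerSeries K) := by
  ext N
  simp only [coeff_subst_mulExpNeg, treeSeries, coeff_mk, sum_treeCoeff, coeff_X]

/-- The power series `∑_{n ≥ 1} n^n z^n / n!`. -/
noncomputable def pointedTreeSeries (K : Type*) [Field K] : PowerSeries K :=
  mk fun n => (n : K) * treeCoeff K n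

theorem pointedTreeSeries_subst_mulExpNeg :
    (pointedTreeSeries K).subst (mulExpNeg K) * (1 - X : PowerSeries K) = X := by
  have : (pointedTreeSeries K).subst (mulExpNeg K) = (X * mk 1 : PowerSeries K) := by
    ext N
    simp only [coeff_subst_mulExpNeg, pointedTreeSeries, coeff_mk, sum_mul_treeCoeff]
    rcases N with _ | N <;> simp [coeff_succ_X_mul]
  rw [this, mul_assoc, mk_one_mul_one_sub_eq_one, mul_one]

theorem constantCoeff_treeSeries {K : Type*} [Field K] : constantCoeff (treeSeries K) = 0 := by
  rw [← coeff_zero_eq_constantCoeff_apply]; simp [treeSeries, treeCoeff]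

theorem hasSubst_treeSeries {K : Type*} [Field K] : HasSubst (treeSeries K) :=
  HasSubst.of_constantCoeff_zero' constantCoeff_treeSeries

/-- T is already a one-sided inverse of ze^{-z}. The linear coefficient of ze^{-z} is 1, so a
two-sided inverse exists and T coincides with it. -/
theorem mulExpNeg_subst_treeSeries : (mulExpNeg K).subst (treeSeries K) = (X : PowerSeries K) := by
  have h1 : coeff 1 (mulExpNeg K) = 1 := by
    have := coeff_mulExpNeg_pow (K := K) 1 1
    simpa using this
  have : Invertible (coeff 1 (mulExpNeg K)) := by rw [h1]; exact invertibleOne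
  have hr := subst_substInv_right (mulExpNeg K) constantCoeff_mulExpNeg
  have : treeSeries K = substInv (mulExpNeg K) := by
    have h := congrArg (PowerSeries.subst (substInv (mulExpNeg K)))
      (treeSeries_subst_mulExpNeg (K := K))
    rw [subst_comp_subst_apply hasSubst_mulExpNeg (HasSubst.substInv _), hr,
      subst_X (HasSubst.substInv _)] at h
    rw [← h, X_subst]
  rw [this, hr]

theorem subst_mulExpNeg_injective {F G : PowerSeries K}
    (h : F.subst (mulExpNeg K) = (G.subst (mulExpNeg K) : PowerSeries K)) : F = G := by
  rw [← X_subst F, ← X_subst G, ← mulExpNeg_subst_treeSeries,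
    ← subst_comp_subst_apply hasSubst_mulExpNeg hasSubst_treeSeries,
    ← subst_comp_subst_apply hasSubst_mulExpNeg hasSubst_treeSeries, h]

theorem subst_one' {K τ : Type*} [Field K] {a : MvPowerSeries τ K} (ha : HasSubst a) :
    (1 : PowerSeries K).subst a = 1 := by
  rw [← coe_substAlgHom ha, map_one]

theorem treeSeries_eq : treeSeries K = X * (exp K).subst (treeSeries K) := by
  have hT := hasSubst_treeSeries (K := K)
  have h := mulExpNeg_subst_treeSeries (K := K)
  have h1 := congrArg (subst (treeSeries K)) (exp_mul_exp_neg_eq_one (A := K))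
  rw [subst_mul hT, subst_one' hT] at h1
  rw [mulExpNeg, subst_mul hT, subst_X hT] at h
  calc treeSeries K = treeSeries K *
        ((exp K).subst (treeSeries K) * (evalNegHom (exp K)).subst (treeSeries K)) := by
        rw [h1]; exact (mul_one _).symm
    _ = (treeSeries K * (evalNegHom (exp K)).subst (treeSeries K)) *
        (exp K).subst (treeSeries K) := by ring
    _ = _ := by rw [h]

/-- Substitution of ze^{-z} is injective and turns the claim into (z/(1-z))(1-z) = z. -/
theorem pointedTreeSeries_mul : pointedTreeSeries K * (1 - treeSeries K) = treeSeries K := by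
  have hf := hasSubst_mulExpNeg (K := K)
  apply subst_mulExpNeg_injective
  rw [subst_mul hf, subst_sub hf, treeSeries_subst_mulExpNeg, subst_one' hf]
  exact pointedTreeSeries_subst_mulExpNeg

theorem mulExpNeg_subst {τ : Type*} {a : MvPowerSeries τ K} (ha : HasSubst a) :
    (mulExpNeg K).subst a = a * (exp K).subst (-a) := by
  rw [mulExpNeg, subst_mul ha, subst_X ha, evalNegHom, rescale_eq_subst,
    subst_comp_subst_apply (HasSubst.smul_X' _) ha, subst_smul ha, subst_X ha, neg_one_smul]

end PowerSeries

/-! ### Chain rule, Euler operators and divisibility by powers of a variable. -/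

namespace MvPowerSeries

open Finsupp

variable {σ R : Type*} [CommRing R]

/-- A fixed coefficient on either side involves only finitely many coefficients of f, because high
powers of g have no terms of low degree. So f may be replaced by a polynomial. -/
theorem pderiv_subst {i : σ} (f : PowerSeries R) {g : MvPowerSeries σ R}
    (hg : PowerSeries.HasSubst g) :
    pderiv R i (f.subst g) = (PowerSeries.derivative R f).subst g * pderiv R i g := by
  classical
  have key : ∀ p : Polynomial R, pderiv R i ((p : PowerSeries R).subst g) =
      (PowerSeries.derivative R (p : PowerSeries R)).subst g * pderiv R i g := by
    intro p
    simp [PowerSeries.subst_coe hg, PowerSeries.derivative_coe,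
      Derivation.comp_aeval_eq (a := g) (pderiv R i) p, smul_eq_mul]
  ext e
  obtain ⟨k, hk⟩ : ∃ k, constantCoeff g ^ k = 0 := id hg
  obtain ⟨m, hm⟩ : ∃ m, ∀ d ≥ m, ∀ e' : σ →₀ ℕ, degree e' ≤ degree e + 1 →
      coeff e' (g ^ d) = 0 :=
    ⟨k + (degree e + 1), fun d hd e' he' =>
      coeff_eq_zero_of_constantCoeff_nilpotent hk (by omega)⟩
  -- The truncation keeps degree m too, since coefficient d of the derivative uses coefficient d+1
  -- of f.
  have h : coeff (e + single i 1) (f.subst g) =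
      coeff (e + single i 1) ((↑(PowerSeries.trunc (m + 1) f) : PowerSeries R).subst g) := by
    rw [PowerSeries.coeff_subst hg, PowerSeries.coeff_subst hg]
    refine finsum_congr fun d => ?_
    obtain hd | hd := lt_or_ge d m
    · rw [PowerSeries.coeff_coe_trunc_of_lt (by omega)]
    · rw [hm d hd _ (by simp), smul_zero, smul_zero]
  rw [coeff_pderiv, h, ← coeff_pderiv, key, coeff_mul, coeff_mul]
  refine Finset.sum_congr rfl fun p hp => ?_
  congr 1
  rw [PowerSeries.coeff_subst hg, PowerSeries.coeff_subst hg]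
  refine finsum_congr fun d => ?_
  obtain hd | hd := lt_or_ge d m
  · rw [PowerSeries.coeff_derivative, PowerSeries.coeff_derivative,
      PowerSeries.coeff_coe_trunc_of_lt (by omega)]
  · have : degree p.1 ≤ degree e + 1 := by
      rw [← Finset.HasAntidiagonal.mem_antidiagonal.1 hp, map_add]; omega
    rw [hm d hd _ this, smul_zero, smul_zero]

theorem rescale_subst [Finite σ] (a : σ → R) (f : PowerSeries R) {g : MvPowerSeries σ R}
    (hg : PowerSeries.HasSubst g) : rescale a (f.subst g) = f.subst (rescale a g) := by
  rw [rescale_eq_subst, rescale_eq_subst, PowerSeries.subst, PowerSeries.subst,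
    subst_comp_subst_apply hg.const (HasSubst.smul_X a)]

theorem coeff_X_mul_pderiv (i : σ) (F : MvPowerSeries σ R) (e : σ →₀ ℕ) :
    coeff e (X i * pderiv R i F) = (e i : R) * coeff e F := by
  classical
  rw [X, coeff_monomial_mul]
  split_ifs with h
  · rw [one_mul, coeff_pderiv, tsub_add_cancel_of_le h]
    have h1 : 1 ≤ e i := by simpa using h i
    simp [Nat.cast_sub h1, mul_comm]
  · have : e i = 0 := by
      by_contra h0
      exact h (by simpa using Nat.one_le_iff_ne_zero.2 h0)
    simp [this]

theorem coeff_X_mul (i : σ) (F : MvPowerSeries σ R) (e : σ →₀ ℕ) :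
    coeff e (X i * F) = if e i = 0 then 0 else coeff (e - single i 1) F := by
  classical
  rw [X, coeff_monomial_mul]
  simp only [single_le_iff, one_mul, Nat.one_le_iff_ne_zero]
  split_ifs <;> simp_all


/-- The power series in which every monomial has degree at least `n` in the variable `i`. -/
def degreeGE (R : Type*) [CommRing R] (i : σ) (n : ℕ) : Ideal (MvPowerSeries σ R) where
  carrier := {F | ∀ e : σ →₀ ℕ, e i < n → coeff e F = 0}
  add_mem' := fun {F G} hF hG e he => by rw [map_add, hF e he, hG e he, add_zero]
  zero_mem' := fun e _ => map_zero _
  smul_mem' := fun G F hF e he => by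
    classical
    rw [smul_eq_mul, coeff_mul]
    refine Finset.sum_eq_zero fun p hp => ?_
    rw [hF p.2 (lt_of_le_of_lt ?_ he), mul_zero]
    rw [← Finset.HasAntidiagonal.mem_antidiagonal.1 hp, Finsupp.add_apply]
    omega

theorem mem_degreeGE {i : σ} {n : ℕ} {F : MvPowerSeries σ R} :
    F ∈ degreeGE R i n ↔ ∀ e : σ →₀ ℕ, e i < n → coeff e F = 0 := Iff.rfl

theorem X_mul_mem_degreeGE {i : σ} {n : ℕ} {F : MvPowerSeries σ R} (hF : F ∈ degreeGE R i n) :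
    X i * F ∈ degreeGE R i (n + 1) := by
  intro e he
  rw [coeff_X_mul]
  split_ifs with h
  · rfl
  · exact hF _ (by simp; omega)

theorem pderiv_mem_degreeGE {i : σ} {n : ℕ} {F : MvPowerSeries σ R}
    (hF : F ∈ degreeGE R i (n + 1)) : pderiv R i F ∈ degreeGE R i n := by
  intro e he
  rw [coeff_pderiv, hF _ (by simpa using he), zero_mul]

theorem pderiv_mem_degreeGE_of_ne {i j : σ} (hij : j ≠ i) {n : ℕ} {F : MvPowerSeries σ R}
    (hF : F ∈ degreeGE R i n) : pderiv R j F ∈ degreeGE R i n := by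
  intro e he
  rw [coeff_pderiv, hF _ (by simpa [single_eq_of_ne hij.symm] using he), zero_mul]

theorem mem_degreeGE_succ_of_pderiv [IsDomain R] [CharZero R] {i : σ} {n : ℕ}
    {F : MvPowerSeries σ R} (h0 : F ∈ degreeGE R i 1) (hF : pderiv R i F ∈ degreeGE R i n) :
    F ∈ degreeGE R i (n + 1) := by
  intro e he
  rcases Nat.eq_zero_or_pos (e i) with h | h
  · exact h0 e (by omega)
  · have hle : single i 1 ≤ e := single_le_iff.2 h
    have := hF (e - single i 1) (by simp; omega)
    rw [coeff_pderiv, tsub_add_cancel_of_le hle] at this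
    exact (mul_eq_zero.1 this).resolve_right (Nat.cast_add_one_ne_zero _)

end MvPowerSeries

/-! ### The differential equation and the identity in K⟦y, t⟧. -/

section FormalIdentity

open MvPowerSeries Finsupp

variable {K : Type*} [Field K]

theorem coeff_stirlingSeries (x : K) (e : Fin 2 →₀ ℕ) :
    coeff e (stirlingSeries x) = if e 0 = 0 then 0 else
      (stirlingB (e 1) (e 0 - 1) : K) * x ^ (2 * e 1 - (e 0 - 1)) / ((e 1).factorial : K) := by
  change ∑ k ∈ Finset.range (e 1 + 1), _ = _
  split_ifs with h
  · exact Finset.sum_eq_zero fun k _ => if_neg (by omega)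
  · rw [Finset.sum_eq_single (e 0 - 1), if_pos (by omega)]
    · intro k _ hk
      exact if_neg (by omega)
    · intro hk
      rw [stirlingB_eq_zero_of_lt (by rw [Finset.mem_range] at hk; omega)]
      simp

theorem constantCoeff_ratioSeries (x : K) : constantCoeff (ratioSeries x) = 0 := by
  simp [ratioSeries]

theorem hasSubst_ratioSeries (x : K) : PowerSeries.HasSubst (ratioSeries x) :=
  PowerSeries.HasSubst.of_constantCoeff_zero (constantCoeff_ratioSeries x)

theorem C_mul_ratioSeries {x : K} (hx : x ≠ 0) : C x * ratioSeries x = X 0 := by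
  rw [ratioSeries, ← mul_assoc, ← map_mul, mul_inv_cancel₀ hx, map_one, one_mul]

theorem hasSubst_exponent (x : K) : PowerSeries.HasSubst
    (-ratioSeries x + diffSeries x ^ 2 * X 1 : MvPowerSeries (Fin 2) K) :=
  PowerSeries.HasSubst.of_constantCoeff_zero (by simp [constantCoeff_ratioSeries])

/-- Rescaling by `![1, 0]` is the specialization t = 0. -/
theorem coeff_rescale_zero {e : Fin 2 →₀ ℕ} (he : e 1 = 0) (F : MvPowerSeries (Fin 2) K) :
    coeff e (rescale ![1, 0] F) = coeff e F := by
  rw [coeff_rescale, Finsupp.prod_fintype _ _ (by simp)]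
  simp [he]

theorem rescale_X_zero : rescale ![1, 0] (X 0 : MvPowerSeries (Fin 2) K) = X 0 := by
  rw [rescale_eq_subst, subst_X (HasSubst.smul_X _)]
  simp

theorem rescale_X_one : rescale ![1, 0] (X 1 : MvPowerSeries (Fin 2) K) = 0 := by
  rw [rescale_eq_subst, subst_X (HasSubst.smul_X _)]
  simp

theorem rescale_C (c : K) : rescale ![1, 0] (C c : MvPowerSeries (Fin 2) K) = C c := by
  rw [rescale_eq_subst, subst_C]

variable [CharZero K]

/-- Coefficientwise this is the recurrence: on y^k tⁿ the operator 2t∂_t + 1 - y∂_y acts as 2n+1-k,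
and on y^{k+1} the operator y∂_y acts as k+1. -/
theorem pderiv_stirlingSeries (x : K) :
    pderiv K 1 (stirlingSeries x) =
      C (x ^ 2) * (X 0 * pderiv K 0 (stirlingSeries x)) +
        C x * (X 0 * (2 * (X 1 * pderiv K 1 (stirlingSeries x)) + stirlingSeries x -
          X 0 * pderiv K 0 (stirlingSeries x))) := by
  ext e
  have h01 : (e + single 1 1 : Fin 2 →₀ ℕ) 0 = e 0 := by simp
  have h11 : (e + single 1 1 : Fin 2 →₀ ℕ) 1 = e 1 + 1 := by simp
  have h2 : (2 : MvPowerSeries (Fin 2) K) = C 2 := (map_ofNat C 2).symm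
  rw [h2, map_add, coeff_C_mul, coeff_C_mul, coeff_X_mul_pderiv, MvPowerSeries.coeff_X_mul, map_sub,
    map_add,
    coeff_C_mul, coeff_pderiv, coeff_X_mul_pderiv, coeff_X_mul_pderiv,
    coeff_stirlingSeries, coeff_stirlingSeries, coeff_stirlingSeries, h01, h11]
  have h00 : (e - single 0 1 : Fin 2 →₀ ℕ) 0 = e 0 - 1 := by simp
  have h10 : (e - single 0 1 : Fin 2 →₀ ℕ) 1 = e 1 := by simp
  rw [h00, h10]
  generalize e 0 = a
  generalize e 1 = n
  have hn : (n.factorial : K) ≠ 0 := by exact_mod_cast n.factorial_ne_zero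
  have hn1 : (n : K) + 1 ≠ 0 := by exact_mod_cast n.succ_ne_zero
  rcases a with _ | _ | j
  · simp
  · simp only [zero_add, one_ne_zero, if_false, tsub_self, if_true, mul_zero, sub_zero, add_zero,
      tsub_zero, stirlingB_succ_zero, Nat.factorial_succ, Nat.cast_mul, Nat.cast_add, Nat.cast_one]
    rw [show 2 * (n + 1) = 2 * n + 2 by ring, pow_add]
    field_simp
  · have hB := congrArg (Int.cast : ℤ → K) (stirlingB_succ_succ n j)
    push_cast at hB
    simp only [Nat.add_sub_cancel, Nat.add_eq_zero_iff, one_ne_zero, and_false, if_false,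
      Nat.factorial_succ, Nat.cast_mul, Nat.cast_add, Nat.cast_one, hB]
    -- Outside this range the exponents of x are truncated subtractions; there B(n, j+1) = 0, and
    -- B(n, j) = 0 too unless j = n = 0, where its factor 2n-j vanishes.
    by_cases hj : j + 1 ≤ 2 * n
    · obtain ⟨m, hm⟩ := Nat.exists_eq_add_of_le hj
      rw [hm, show 2 * (n + 1) - (j + 1) = m + 2 by omega, show j + 1 + m - (j + 1) = m by omega,
        show j + 1 + m - j = m + 1 by omega]
      field_simp
      ring
    · rw [stirlingB_eq_zero_of_lt (show n < j + 1 by omega)]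
      rcases Nat.lt_or_ge n j with h | h
      · rw [stirlingB_eq_zero_of_lt h]; simp
      · obtain ⟨rfl, rfl⟩ : j = 0 ∧ n = 0 := by omega
        simp

/-- If the difference H is divisible by t^{n+1}, the right-hand side of the equation is too, since
∂_t occurs there only as t∂_t. Hence so is H_t, and H, having no terms free of t, is divisible by
t^{n+2}. -/
theorem eq_of_pderiv_eq {x : K} {F G : MvPowerSeries (Fin 2) K}
    (hF : pderiv K 1 F = C (x ^ 2) * (X 0 * pderiv K 0 F) +
        C x * (X 0 * (2 * (X 1 * pderiv K 1 F) + F - X 0 * pderiv K 0 F)))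
    (hG : pderiv K 1 G = C (x ^ 2) * (X 0 * pderiv K 0 G) +
        C x * (X 0 * (2 * (X 1 * pderiv K 1 G) + G - X 0 * pderiv K 0 G)))
    (h0 : ∀ e : Fin 2 →₀ ℕ, e 1 = 0 → coeff e F = coeff e G) : F = G := by
  have hH1 : F - G ∈ degreeGE K (1 : Fin 2) 1 := fun e he => by
    rw [map_sub, h0 e (by omega), sub_self]
  have hH : ∀ n, F - G ∈ degreeGE K (1 : Fin 2) (n + 1) := by
    intro n
    induction n with
    | zero => exact hH1
    | succ n ih =>
      refine mem_degreeGE_succ_of_pderiv hH1 ?_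
      have e : pderiv K 1 (F - G) = C (x ^ 2) * (X 0 * pderiv K 0 (F - G)) +
          C x * (X 0 * (2 * (X 1 * pderiv K 1 (F - G)) + (F - G) - X 0 * pderiv K 0 (F - G))) := by
        simp only [map_sub]
        linear_combination hF - hG
      rw [e]
      have h1 := pderiv_mem_degreeGE_of_ne (j := 0) (by decide) ih
      have h2 := X_mul_mem_degreeGE (pderiv_mem_degreeGE ih)
      refine Ideal.add_mem _ (Ideal.mul_mem_left _ _ (Ideal.mul_mem_left _ _ h1))
        (Ideal.mul_mem_left _ _ (Ideal.mul_mem_left _ _ (Ideal.sub_mem _ (Ideal.add_mem _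
          (Ideal.mul_mem_left _ _ h2) ih) (Ideal.mul_mem_left _ _ h1))))
  ext e
  rw [← sub_eq_zero, ← map_sub]
  exact hH (e 1) e (by omega)

theorem constantCoeff_wSeries (x : K) : constantCoeff (wSeries x) = 0 := by
  simp [wSeries, constantCoeff_ratioSeries]

theorem hasSubst_wSeries (x : K) : PowerSeries.HasSubst (wSeries x) :=
  PowerSeries.HasSubst.of_constantCoeff_zero (constantCoeff_wSeries x)

/-- No condition on f is needed: w_t = (x-y)²w and yw_y = (1 - y/x - 2y(x-y)t)w, so the terms with
f' cancel, and the factor x-y accounts for the terms with f. -/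
theorem pderiv_subst_wSeries {x : K} (hx : x ≠ 0) (f : PowerSeries K) {R : MvPowerSeries (Fin 2) K}
    (hR : R = diffSeries x * f.subst (wSeries x)) :
    pderiv K 1 R = C (x ^ 2) * (X 0 * pderiv K 0 R) +
        C x * (X 0 * (2 * (X 1 * pderiv K 1 R) + R - X 0 * pderiv K 0 R)) := by
  set E := (PowerSeries.exp K).subst
      (-ratioSeries x + diffSeries x ^ 2 * X 1 : MvPowerSeries (Fin 2) K) with hE
  have hW : wSeries x = ratioSeries x * E := rfl
  have hd : diffSeries x = C x - X 0 := rfl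
  have hr : ratioSeries x = C x⁻¹ * X 0 := rfl
  have hc : C x * C x⁻¹ = (1 : MvPowerSeries (Fin 2) K) := by
    rw [← map_mul, mul_inv_cancel₀ hx, map_one]
  have d0d : pderiv K 0 (diffSeries x) = -1 := by simp [diffSeries]
  have d1d : pderiv K 1 (diffSeries x) = 0 := by simp [diffSeries, pderiv_X_of_ne]
  have d0r : pderiv K 0 (ratioSeries x) = C x⁻¹ := by simp [ratioSeries]
  have d1r : pderiv K 1 (ratioSeries x) = 0 := by simp [ratioSeries, pderiv_X_of_ne]
  have dE : ∀ i, pderiv K i E =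
      E * pderiv K i (-ratioSeries x + diffSeries x ^ 2 * X 1 : MvPowerSeries (Fin 2) K) := by
    intro i
    rw [hE, pderiv_subst _ (hasSubst_exponent x), PowerSeries.derivative_exp]
  have d0E : pderiv K 0 E = E * (-C x⁻¹ - 2 * diffSeries x * X 1) := by
    rw [dE, map_add, map_neg, d0r, Derivation.leibniz, Derivation.leibniz_pow, d0d,
      pderiv_X_of_ne (by decide)]
    simp only [smul_eq_mul, nsmul_eq_mul]
    push_cast
    ring
  have d1E : pderiv K 1 E = E * diffSeries x ^ 2 := by
    rw [dE, map_add, map_neg, d1r, Derivation.leibniz, Derivation.leibniz_pow, d1d,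
      pderiv_X_self]
    simp
  have d0W : pderiv K 0 (wSeries x) =
      C x⁻¹ * E + wSeries x * (-C x⁻¹ - 2 * diffSeries x * X 1) := by
    rw [hW, Derivation.leibniz, d0r, d0E]
    simp only [smul_eq_mul]
    ring
  have d1W : pderiv K 1 (wSeries x) = wSeries x * diffSeries x ^ 2 := by
    rw [hW, Derivation.leibniz, d1r, d1E]
    simp only [smul_eq_mul]
    ring
  set Z := (PowerSeries.derivative K f).subst (wSeries x)
  have d0R : pderiv K 0 R = -f.subst (wSeries x) + diffSeries x * (Z *
      (C x⁻¹ * E + wSeries x * (-C x⁻¹ - 2 * diffSeries x * X 1))) := by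
    rw [hR, Derivation.leibniz, d0d, pderiv_subst _ (hasSubst_wSeries x), d0W]
    simp only [smul_eq_mul]
    ring
  have d1R : pderiv K 1 R = diffSeries x * (Z * (wSeries x * diffSeries x ^ 2)) := by
    rw [hR, Derivation.leibniz, d1d, pderiv_subst _ (hasSubst_wSeries x), d1W]
    simp only [smul_eq_mul]
    ring
  rw [d0R, d1R, hR, hW, hr, hd, map_pow]
  generalize hu : (C x⁻¹ : MvPowerSeries (Fin 2) K) = u at *
  generalize hv : (C x : MvPowerSeries (Fin 2) K) = v at *
  generalize (X 0 : MvPowerSeries (Fin 2) K) = y at *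
  generalize (X 1 : MvPowerSeries (Fin 2) K) = t at *
  generalize f.subst (wSeries x) = g at *
  clear_value E Z
  linear_combination (v - y) ^ 2 * y ^ 2 * Z * u * E * hc

theorem rescale_wSeries (x : K) : rescale ![1, 0] (wSeries x) =
    (PowerSeries.mulExpNeg K).subst (ratioSeries x) := by
  have hr : rescale ![1, 0] (ratioSeries x) = ratioSeries x := by
    rw [ratioSeries, map_mul, rescale_X_zero, rescale_C]
  rw [PowerSeries.mulExpNeg_subst (hasSubst_ratioSeries x), wSeries, map_mul, hr,
    rescale_subst _ _ (hasSubst_exponent x), map_add, map_neg, hr, map_mul, rescale_X_one, mul_zero,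
    add_zero]

/-- At t = 0, with z = y/x, the product is x(1-z) · z/(1-z) = y. -/
theorem rescale_mul_subst_wSeries {x : K} (hx : x ≠ 0) :
    rescale ![1, 0] (diffSeries x * (PowerSeries.pointedTreeSeries K).subst (wSeries x)) = X 0 := by
  have hρ := hasSubst_ratioSeries x
  have hd : rescale ![1, 0] (diffSeries x) = C x * (1 - ratioSeries x) := by
    rw [mul_sub, C_mul_ratioSeries hx, mul_one, diffSeries, map_sub, rescale_X_zero, rescale_C]
  have h := congrArg (PowerSeries.subst (ratioSeries x))
    (PowerSeries.pointedTreeSeries_subst_mulExpNeg (K := K))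
  rw [PowerSeries.subst_mul hρ, PowerSeries.subst_sub hρ, PowerSeries.subst_X hρ,
    PowerSeries.subst_one' hρ,
    PowerSeries.subst_comp_subst_apply PowerSeries.hasSubst_mulExpNeg hρ] at h
  rw [map_mul, rescale_subst _ _ (hasSubst_wSeries x), rescale_wSeries, hd, mul_right_comm,
    mul_assoc, h, C_mul_ratioSeries hx]

theorem stirlingSeries_eq {x : K} (hx : x ≠ 0) :
    stirlingSeries x = diffSeries x * (treeSeries K).subst (wSeries x) *
      (1 - (treeSeries K).subst (wSeries x))⁻¹ := by
  have hw := hasSubst_wSeries x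
  have h1 : stirlingSeries x =
      diffSeries x * (PowerSeries.pointedTreeSeries K).subst (wSeries x) := by
    refine eq_of_pderiv_eq (pderiv_stirlingSeries x) (pderiv_subst_wSeries hx _ rfl) ?_
    intro e he
    rw [← coeff_rescale_zero he (diffSeries x * _), rescale_mul_subst_wSeries hx,
      coeff_stirlingSeries, he, stirlingB_zero, coeff_X]
    have h' : e = single 0 1 ↔ e 0 = 1 := by
      constructor
      · rintro rfl; simp
      · intro h
        ext i
        fin_cases i <;> simp [h, he]
    simp only [h']
    rcases h0 : e 0 with _ | _ | k <;> simp
  have h2 := congrArg (PowerSeries.subst (wSeries x)) (PowerSeries.pointedTreeSeries_mul (K := K))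
  rw [PowerSeries.subst_mul hw, PowerSeries.subst_sub hw, PowerSeries.subst_one' hw] at h2
  have h3 : constantCoeff (1 - (treeSeries K).subst (wSeries x)) ≠ 0 := by
    rw [map_sub, map_one, PowerSeries.constantCoeff_subst_eq_zero (constantCoeff_wSeries x) _
      PowerSeries.constantCoeff_treeSeries]
    simp
  rw [MvPowerSeries.eq_mul_inv_iff_mul_eq h3, h1, mul_assoc, h2]

end FormalIdentity

/-! ### The tree function as an analytic function. -/

section TreeFunction

open Filter Topology

theorem norm_treeCoeff_le (n : ℕ) : ‖treeCoeff ℂ n‖ ≤ Real.exp n := by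
  rw [treeCoeff]
  split_ifs with h
  · simpa using (Real.exp_pos _).le
  · rw [norm_div, norm_pow, Complex.norm_natCast, Complex.norm_natCast]
    refine le_trans ?_ (Real.pow_div_factorial_le_exp (n : ℝ) n.cast_nonneg n)
    gcongr
    · exact_mod_cast Nat.one_le_iff_ne_zero.2 h
    · omega

theorem summable_norm_treeCoeff (j : ℕ) {r : ℝ} (h0 : 0 ≤ r) (hr : r < Real.exp (-1)) :
    Summable fun m : ℕ => ‖(m : ℂ) ^ j * treeCoeff ℂ m‖ * r ^ m := by
  have h1 : ‖Real.exp 1 * r‖ < 1 := by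
    rw [Real.norm_of_nonneg (by positivity)]
    calc Real.exp 1 * r < Real.exp 1 * Real.exp (-1) := by gcongr
      _ = 1 := by rw [← Real.exp_add]; simp
  refine Summable.of_nonneg_of_le (fun m => by positivity) (fun m => ?_)
    (summable_pow_mul_geometric_of_norm_lt_one j h1)
  rw [norm_mul, norm_pow, Complex.norm_natCast, mul_pow, ← Real.exp_nat_mul, mul_one, mul_assoc]
  gcongr
  exact norm_treeCoeff_le m

/-- The function `∑_{m ≥ 1} m^{m - 1 + j} w^m / m!`. -/
noncomputable def treeMoment (j : ℕ) (w : ℂ) : ℂ := ∑' m : ℕ, (m : ℂ) ^ j * treeCoeff ℂ m * w ^ m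

theorem treeMoment_zero : treeMoment 0 = treeFun := by
  funext w; simp [treeMoment, treeFun]

theorem summable_treeMoment (j : ℕ) {w : ℂ} (hw : ‖w‖ < Real.exp (-1)) :
    Summable fun m : ℕ => (m : ℂ) ^ j * treeCoeff ℂ m * w ^ m := by
  refine Summable.of_norm ?_
  simp only [norm_mul _ (w ^ _), norm_pow w]
  exact summable_norm_treeCoeff j (norm_nonneg w) hw

/-- Differentiation of `treeMoment`. -/
theorem treeMoment_hasDerivAt (j : ℕ) {w : ℂ} (hw : ‖w‖ < Real.exp (-1)) :
    ∃ D, HasDerivAt (treeMoment j) D w ∧ w * D = treeMoment (j + 1) w := by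
  obtain ⟨r, hwr, hr⟩ := exists_between hw
  have hw' : w ∈ Metric.ball (0 : ℂ) r := by simpa using hwr
  have hu := summable_norm_treeCoeff j ((norm_nonneg w).trans hwr.le) hr
  have hF : ∀ m : ℕ, DifferentiableOn ℂ (fun w : ℂ => (m : ℂ) ^ j * treeCoeff ℂ m * w ^ m)
      (Metric.ball 0 r) := fun m => by fun_prop
  have hle : ∀ (m : ℕ) (z : ℂ), z ∈ Metric.ball (0 : ℂ) r →
      ‖(m : ℂ) ^ j * treeCoeff ℂ m * z ^ m‖ ≤ ‖(m : ℂ) ^ j * treeCoeff ℂ m‖ * r ^ m := by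
    intro m z hz
    rw [norm_mul _ (z ^ m), norm_pow z]
    have : ‖z‖ < r := by simpa using hz
    gcongr
  have hd := Complex.differentiableOn_tsum_of_summable_norm hu hF Metric.isOpen_ball hle
  have hs := (Complex.hasSum_deriv_of_summable_norm hu hF Metric.isOpen_ball hle hw').mul_left w
  refine ⟨_, (hd.differentiableAt (Metric.isOpen_ball.mem_nhds hw')).hasDerivAt, ?_⟩
  rw [← hs.tsum_eq, treeMoment]
  refine tsum_congr fun m => ?_
  rw [deriv_const_mul_field, deriv_pow_field]
  rcases m with _ | m
  · simp
  · rw [Nat.add_sub_cancel]; ring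

theorem differentiableOn_treeMoment (j : ℕ) :
    DifferentiableOn ℂ (treeMoment j) (Metric.ball 0 (Real.exp (-1))) := fun w hw => by
  obtain ⟨D, hD, -⟩ := treeMoment_hasDerivAt j (w := w) (by simpa using hw)
  exact hD.differentiableAt.differentiableWithinAt

/-- Expansion of exponentials in a series of exponentials. -/
theorem hasSum_mul_exp {a : ℕ → ℂ} {v : ℂ}
    (h : Summable fun d : ℕ => ‖a d‖ * Real.exp (d * ‖v‖)) :
    HasSum (fun p : ℕ × ℕ => a p.1 * ((p.1 * v) ^ p.2 / (p.2.factorial : ℂ)))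
      (∑' d : ℕ, a d * Complex.exp (d * v)) := by
  have hc : ∀ d : ℕ, HasSum (fun i : ℕ => a d * ((d * v) ^ i / (i.factorial : ℂ)))
      (a d * Complex.exp (d * v)) := fun d => by
    rw [Complex.exp_eq_exp_ℂ]
    exact (NormedSpace.expSeries_div_hasSum_exp (d * v)).mul_left (a d)
  have hr : ∀ d : ℕ, HasSum (fun i : ℕ => ‖a d * ((d * v) ^ i / (i.factorial : ℂ))‖)
      (‖a d‖ * Real.exp (d * ‖v‖)) := fun d => by
    rw [Real.exp_eq_exp_ℝ]
    convert! (NormedSpace.expSeries_div_hasSum_exp ((d : ℝ) * ‖v‖)).mul_left ‖a d‖ using 2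
    simp
  have hs : Summable fun p : ℕ × ℕ => a p.1 * ((p.1 * v) ^ p.2 / (p.2.factorial : ℂ)) := by
    refine Summable.of_norm ((summable_prod_of_nonneg fun p => norm_nonneg _).2
      ⟨fun d => (hr d).summable, ?_⟩)
    simpa only [(hr _).tsum_eq] using h
  have := hs.hasSum.prod_fiberwise hc
  rw [this.tsum_eq]
  exact hs.hasSum

/-- Near the origin the tree function inverts `z e^{-z}`. -/
theorem treeFun_mul_exp_neg_of_small {z : ℂ} (hz : ‖z‖ * Real.exp ‖z‖ < Real.exp (-1)) :
    treeFun (z * Complex.exp (-z)) = z := by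
  have hsum : Summable fun d : ℕ => ‖treeCoeff ℂ d * z ^ d‖ * Real.exp (d * ‖-z‖) := by
    have := summable_norm_treeCoeff 0 (by positivity) hz
    simpa only [pow_zero, one_mul, mul_pow, ← Real.exp_nat_mul, norm_mul, norm_pow, norm_neg,
      mul_assoc] using this
  have h1 := hasSum_mul_exp hsum
  have h2 : treeFun (z * Complex.exp (-z)) =
      ∑' d : ℕ, treeCoeff ℂ d * z ^ d * Complex.exp (d * -z) := by
    refine tsum_congr fun d => ?_
    rw [mul_pow, ← Complex.exp_nat_mul, mul_assoc]
  -- Grouping the absolutely convergent double series by N = d + i collects the coefficient of z^N,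
  -- which `sum_treeCoeff` evaluates.
  rw [h2, ← h1.tsum_eq,
    ← Finset.HasAntidiagonal.sigmaAntidiagonalEquivProd.tsum_eq]
  have hs := (Finset.HasAntidiagonal.sigmaAntidiagonalEquivProd (A := ℕ)).summable_iff.2 h1.summable
  have h3 := hs.hasSum.sigma fun N => hasSum_fintype _
  have h4 : ∀ N : ℕ, (∑ c : Finset.HasAntidiagonal.antidiagonal N,
      ((fun p : ℕ × ℕ => treeCoeff ℂ p.1 * z ^ p.1 * ((p.1 * -z) ^ p.2 / (p.2.factorial : ℂ))) ∘
        Finset.HasAntidiagonal.sigmaAntidiagonalEquivProd) ⟨N, c⟩) = if N = 1 then z else 0 := by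
    intro N
    have : ∀ c : Finset.HasAntidiagonal.antidiagonal N,
        ((fun p : ℕ × ℕ => treeCoeff ℂ p.1 * z ^ p.1 * ((p.1 * -z) ^ p.2 / (p.2.factorial : ℂ))) ∘
        Finset.HasAntidiagonal.sigmaAntidiagonalEquivProd) ⟨N, c⟩ =
        (fun p : ℕ × ℕ => (treeCoeff ℂ p.1 * ((-(p.1 : ℂ)) ^ p.2 / (p.2.factorial : ℂ))) * z ^ N)
          c := by
      rintro ⟨⟨d, i⟩, hc⟩
      rw [Finset.HasAntidiagonal.mem_antidiagonal] at hc
      simp only [Function.comp_apply,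
        Finset.HasAntidiagonal.sigmaAntidiagonalEquivProd_apply] at hc ⊢
      rw [← hc, pow_add, mul_neg, ← neg_mul, mul_pow]
      ring
    rw [Finset.sum_congr rfl fun c _ => this c, Finset.sum_coe_sort (f := fun p : ℕ × ℕ =>
      (treeCoeff ℂ p.1 * ((-(p.1 : ℂ)) ^ p.2 / (p.2.factorial : ℂ))) * z ^ N), ← Finset.sum_mul,
      Finset.Nat.sum_antidiagonal_eq_sum_range_succ
        (fun d i => treeCoeff ℂ d * ((-(d : ℂ)) ^ i / (i.factorial : ℂ))), sum_treeCoeff]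
    split_ifs with h <;> simp [h]
  simp only [h4] at h3
  exact h3.unique (hasSum_ite_eq 1 z)

/-- The domain on which the tree function inverts `z e^{-z}`. -/
def treeDomain : Set ℂ := {z | ‖z‖ < 1 ∧ ‖z * Complex.exp (-z)‖ < Real.exp (-1)}

theorem isOpen_treeDomain : IsOpen treeDomain :=
  (isOpen_lt continuous_norm continuous_const).inter
    (isOpen_lt (f := fun z : ℂ => ‖z * Complex.exp (-z)‖) (by fun_prop) continuous_const)

theorem zero_mem_treeDomain : (0 : ℂ) ∈ treeDomain := by simp [treeDomain, Real.exp_pos]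

/-- Replacing z by sz does not increase |ze^{-z}|: this amounts to s ≤ e^{-(1-s) Re z}, which
follows from Re z ≤ 1 and s ≤ e^{s-1}. The domain is thus connected, as the identity theorem
requires. -/
theorem starConvex_treeDomain : StarConvex ℝ 0 treeDomain := by
  rw [starConvex_zero_iff]
  rintro z ⟨hz1, hz2⟩ s hs0 hs1
  constructor
  · rw [norm_smul, Real.norm_of_nonneg hs0]
    calc s * ‖z‖ ≤ 1 * ‖z‖ := by gcongr
      _ < 1 := by rwa [one_mul]
  · refine lt_of_le_of_lt ?_ hz2
    rw [norm_mul, norm_mul, norm_smul, Real.norm_of_nonneg hs0, Complex.norm_exp, Complex.norm_exp]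
    have hre : z.re ≤ 1 := (Complex.re_le_norm z).trans hz1.le
    have h1 : s ≤ Real.exp (-((1 - s) * z.re)) := by
      calc s ≤ Real.exp (s - 1) := by linarith [Real.add_one_le_exp (s - 1)]
        _ ≤ _ := by
          rw [Real.exp_le_exp]
          nlinarith
    have h2 : Real.exp (-z).re = Real.exp (-((1 - s) * z.re)) * Real.exp (-(s • z)).re := by
      rw [← Real.exp_add]
      congr 1
      simp
      ring
    rw [h2]
    calc s * ‖z‖ * Real.exp (-(s • z)).re
        ≤ Real.exp (-((1 - s) * z.re)) * ‖z‖ * Real.exp (-(s • z)).re := by gcongr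
      _ = _ := by ring

theorem eventually_treeFun_mul_exp_neg :
    ∀ᶠ z in 𝓝 (0 : ℂ), treeFun (z * Complex.exp (-z)) = z := by
  have h : Tendsto (fun z : ℂ => ‖z‖ * Real.exp ‖z‖) (𝓝 0) (𝓝 (‖(0 : ℂ)‖ * Real.exp ‖(0 : ℂ)‖)) :=
    Continuous.tendsto (by fun_prop) 0
  rw [norm_zero, zero_mul] at h
  filter_upwards [h.eventually_lt_const (Real.exp_pos (-1))] with z hz
  exact treeFun_mul_exp_neg_of_small hz

theorem treeFun_mul_exp_neg {z : ℂ} (hz : z ∈ treeDomain) :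
    treeFun (z * Complex.exp (-z)) = z := by
  have h1 : AnalyticOnNhd ℂ (fun z : ℂ => treeFun (z * Complex.exp (-z))) treeDomain := by
    refine DifferentiableOn.analyticOnNhd ?_ isOpen_treeDomain
    have := differentiableOn_treeMoment 0
    rw [treeMoment_zero] at this
    refine this.comp (by fun_prop) fun z hz => ?_
    simpa using hz.2
  exact h1.eqOn_of_preconnected_of_eventuallyEq analyticOnNhd_id
    (starConvex_treeDomain.isPathConnected zero_mem_treeDomain).isConnected.isPreconnected
    zero_mem_treeDomain eventually_treeFun_mul_exp_neg hz

/-- Since ze^{-z} has derivative 1 at 0, it maps neighbourhoods of 0 onto neighbourhoods of 0. Every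
small w therefore has the form ze^{-z} with T(w) = z, and the identity theorem extends the equation
to the disc. -/
theorem treeFun_mul_exp_neg_treeFun {w : ℂ} (hw : ‖w‖ < Real.exp (-1)) :
    treeFun w * Complex.exp (-treeFun w) = w := by
  have hd := differentiableOn_treeMoment 0
  rw [treeMoment_zero] at hd
  have h1 : AnalyticOnNhd ℂ (fun w : ℂ => treeFun w * Complex.exp (-treeFun w))
      (Metric.ball 0 (Real.exp (-1))) :=
    DifferentiableOn.analyticOnNhd (hd.mul hd.neg.cexp) Metric.isOpen_ball
  have h2 : HasStrictDerivAt (fun z : ℂ => z * Complex.exp (-z)) 1 0 := by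
    convert! (hasStrictDerivAt_id (0 : ℂ)).mul (hasStrictDerivAt_id (0 : ℂ)).neg.cexp using 1
    simp
  have h3 := h2.map_nhds_eq one_ne_zero
  simp only [zero_mul] at h3
  have h4 : ∀ᶠ w in 𝓝 (0 : ℂ), treeFun w * Complex.exp (-treeFun w) = w := by
    rw [← h3, eventually_map]
    filter_upwards [eventually_treeFun_mul_exp_neg] with z hz
    rw [hz]
  exact h1.eqOn_of_preconnected_of_eventuallyEq analyticOnNhd_id
    (convex_ball 0 _).isPreconnected (Metric.mem_ball_self (Real.exp_pos _)) h4 (by simpa using hw)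

theorem treeFun_eq {w : ℂ} (hw : ‖w‖ < Real.exp (-1)) :
    treeFun w = w * Complex.exp (treeFun w) := by
  have h := congrArg (· * Complex.exp (treeFun w)) (treeFun_mul_exp_neg_treeFun hw)
  simpa [mul_assoc, ← Complex.exp_add] using h

/-- Differentiating Te^{-T} = w gives T'(1-T)e^{-T} = 1, and `treeMoment 1 w` is wT'(w). -/
theorem treeMoment_one_mul {w : ℂ} (hw : ‖w‖ < Real.exp (-1)) :
    treeMoment 1 w * (1 - treeFun w) = treeFun w := by
  obtain ⟨D, hD, hwD⟩ := treeMoment_hasDerivAt 0 hw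
  rw [treeMoment_zero] at hD
  have h1 : HasDerivAt (fun w => treeFun w * Complex.exp (-treeFun w)) _ w := hD.mul hD.neg.cexp
  have h2 : (fun w => treeFun w * Complex.exp (-treeFun w)) =ᶠ[𝓝 w] id := by
    filter_upwards [(isOpen_lt continuous_norm continuous_const).mem_nhds hw] with v hv
    exact treeFun_mul_exp_neg_treeFun hv
  have h3 := (h1.congr_of_eventuallyEq h2.symm).unique (hasDerivAt_id w)
  rw [zero_add] at hwD
  have h4 := treeFun_mul_exp_neg_treeFun hw
  have h5 : Complex.exp (-treeFun w) ≠ 0 := Complex.exp_ne_zero _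
  apply mul_right_cancel₀ h5
  rw [← hwD]
  linear_combination w * h3 - h4

theorem treeFun_ne_one {w : ℂ} (hw : ‖w‖ < Real.exp (-1)) : treeFun w ≠ 1 := fun h => by
  have := treeMoment_one_mul hw
  rw [h] at this
  simp at this

/-! ### Stirling polynomials and the numerical identity. -/

/-- The polynomial `∑_k B(n, k) z^{k+1}`. -/
noncomputable def stirlingPoly (n : ℕ) (z : ℂ) : ℂ :=
  ∑ k ∈ Finset.range (n + 1), (stirlingB n k : ℂ) * z ^ (k + 1)

theorem stirlingPoly_hasDerivAt (n : ℕ) (z : ℂ) : HasDerivAt (stirlingPoly n)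
    (∑ k ∈ Finset.range (n + 1), (stirlingB n k : ℂ) * (((k + 1 : ℕ) : ℂ) * z ^ k)) z := by
  refine HasDerivAt.fun_sum fun k _ => ?_
  simpa using (hasDerivAt_pow (k + 1) z).const_mul (stirlingB n k : ℂ)

theorem stirlingPoly_succ {n : ℕ} {z D : ℂ} (hD : HasDerivAt (stirlingPoly n) D z) :
    stirlingPoly (n + 1) z = z * (1 - z) * D + (2 * n + 1) * z * stirlingPoly n z := by
  rw [hD.unique (stirlingPoly_hasDerivAt n z)]
  have hB : ∀ k : ℕ, (stirlingB (n + 1) (k + 1) : ℂ) =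
      ((k : ℂ) + 2) * stirlingB n (k + 1) + (2 * (n : ℂ) - k) * stirlingB n k := fun k => by
    exact_mod_cast congrArg (Int.cast : ℤ → ℂ) (stirlingB_succ_succ n k)
  have h1 : ∑ k ∈ Finset.range (n + 1), (stirlingB n k : ℂ) * ((k + 1 : ℂ) * z ^ (k + 1)) =
      (∑ k ∈ Finset.range (n + 1), (stirlingB n (k + 1) : ℂ) * ((k + 2 : ℂ) * z ^ (k + 2))) +
        stirlingB n 0 * z := by
    have h := Finset.sum_range_succ
      (fun k : ℕ => (stirlingB n k : ℂ) * ((k + 1 : ℂ) * z ^ (k + 1))) (n + 1)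
    rw [stirlingB_eq_zero_of_lt (Nat.lt_succ_self n), Nat.cast_zero, zero_mul, add_zero] at h
    rw [← h, Finset.sum_range_succ']
    push_cast
    simp only [zero_add, one_mul, pow_one, add_assoc, one_add_one_eq_two]
  rw [stirlingPoly, stirlingPoly, Finset.sum_range_succ', stirlingB_succ_zero]
  simp only [hB, zero_add, pow_one]
  have h2 : z * (1 - z) * ∑ k ∈ Finset.range (n + 1),
      (stirlingB n k : ℂ) * (((k + 1 : ℕ) : ℂ) * z ^ k) =
      ∑ k ∈ Finset.range (n + 1), (stirlingB n k : ℂ) * ((k + 1 : ℂ) * z ^ (k + 1)) -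
      ∑ k ∈ Finset.range (n + 1), (stirlingB n k : ℂ) * ((k + 1 : ℂ) * z ^ (k + 2)) := by
    rw [Finset.mul_sum, ← Finset.sum_sub_distrib]
    refine Finset.sum_congr rfl fun k _ => ?_
    push_cast
    ring
  rw [h2, h1, Finset.mul_sum, add_sub_right_comm, add_right_comm, ← Finset.sum_sub_distrib,
    ← Finset.sum_add_distrib]
  congr 1
  refine Finset.sum_congr rfl fun k _ => ?_
  ring

/-- With w = ze^{-z}, the operator w d/dw equals (z/(1-z)) d/dz. It raises the moment by one, and by
`stirlingPoly_succ` it sends P_n/(1-z)^{2n+1} to P_{n+1}/(1-z)^{2n+3}. -/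
theorem stirlingPoly_eq (n : ℕ) {z : ℂ} (hz : z ∈ treeDomain) :
    stirlingPoly n z = (1 - z) ^ (2 * n + 1) * treeMoment (n + 1) (z * Complex.exp (-z)) := by
  induction n generalizing z with
  | zero =>
    have := treeMoment_one_mul hz.2
    rw [treeFun_mul_exp_neg hz] at this
    simp only [stirlingPoly, zero_add, Finset.sum_range_one, stirlingB_zero, if_true, mul_zero,
      pow_one, Nat.cast_one, one_mul]
    rw [mul_comm, this]
  | succ n ih =>
    obtain ⟨D, hD, hwD⟩ := treeMoment_hasDerivAt (n + 1) hz.2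
    have h1 : HasDerivAt (fun z : ℂ => z * Complex.exp (-z))
        (1 * Complex.exp (-z) + z * (Complex.exp (-z) * -1)) z :=
      (hasDerivAt_id z).mul (hasDerivAt_id z).neg.cexp
    have h2 := (((hasDerivAt_const z (1 : ℂ)).sub (hasDerivAt_id z)).pow (2 * n + 1)).mul
      (hD.comp z h1)
    have h3 := h2.congr_of_eventuallyEq (f₁ := stirlingPoly n)
      (by filter_upwards [isOpen_treeDomain.mem_nhds hz] with v hv; exact ih hv)
    rw [stirlingPoly_succ h3, ih hz, ← hwD]
    simp
    ring

/-- With y = xz, f = ze^{-z} and s = (x-y)²t, the n-th term is (x-y) sⁿ/n! ∑_m m^{n+1} c_m f^m,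
where c_m is the tree coefficient. Summing over n first gives m c_m (fe^s)^m, and the bound
|f|e^{|s|} < e^{-1} is what makes the double series absolutely convergent. -/
theorem hasSum_stirlingB {x y t : ℂ} (hxy : ‖y‖ < ‖x‖)
    (h : ‖y / x * Complex.exp (-(y / x))‖ * Real.exp ‖(x - y) ^ 2 * t‖ < Real.exp (-1)) :
    HasSum (fun n : ℕ => (∑ k ∈ Finset.range (n + 1),
        (stirlingB n k : ℂ) * x ^ (2 * n - k) * y ^ (k + 1)) * (t ^ n / n.factorial))
      ((x - y) * treeMoment 1 (wNumber x y t)) := by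
  have hx : x ≠ 0 := fun h0 => by simp [h0] at hxy; exact absurd hxy (norm_nonneg y).not_gt
  obtain ⟨z, rfl⟩ : ∃ z, y = x * z := ⟨y / x, by field_simp⟩
  rw [wNumber]
  rw [mul_div_cancel_left₀ _ hx] at h ⊢
  have hz : z ∈ treeDomain := by
    refine ⟨?_, lt_of_le_of_lt (le_mul_of_one_le_right (norm_nonneg _) ?_) h⟩
    · rw [norm_mul] at hxy
      by_contra hc
      nlinarith [norm_nonneg x]
    · exact Real.one_le_exp (norm_nonneg _)
  set s := (x - x * z) ^ 2 * t with hs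
  set f := z * Complex.exp (-z) with hf
  have hsum : Summable fun d : ℕ => ‖(d : ℂ) ^ 1 * treeCoeff ℂ d * f ^ d‖ * Real.exp (d * ‖s‖) := by
    have := summable_norm_treeCoeff 1 (by positivity) h
    refine this.congr fun d => ?_
    rw [mul_pow, ← Real.exp_nat_mul, norm_mul _ (f ^ d), norm_pow f, mul_assoc _ (‖f‖ ^ d)]
  have h1 := hasSum_mul_exp hsum
  have h2 : ∑' d : ℕ, (d : ℂ) ^ 1 * treeCoeff ℂ d * f ^ d * Complex.exp (d * s) =
      treeMoment 1 (z * Complex.exp (-z + s)) := by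
    refine tsum_congr fun d => ?_
    rw [Complex.exp_add, ← mul_assoc z, ← hf, mul_pow f, ← Complex.exp_nat_mul s,
      mul_assoc _ (f ^ d)]
  rw [h2] at h1
  have hfn : ‖f‖ < Real.exp (-1) := hz.2
  clear_value f
  -- The double series is now summed over m for fixed n.
  have h3 := ((Equiv.prodComm ℕ ℕ).hasSum_iff.2 h1).prod_fiberwise (f := _)
    (g := fun n : ℕ => s ^ n / n.factorial * treeMoment (n + 1) f) fun n => by
      convert! (summable_treeMoment (n + 1) hfn).hasSum.mul_left
        (s ^ n / (n.factorial : ℂ)) using 2 with m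
      change (m : ℂ) ^ 1 * treeCoeff ℂ m * f ^ m * ((m * s) ^ n / n.factorial) =
        s ^ n / n.factorial * ((m : ℂ) ^ (n + 1) * treeCoeff ℂ m * f ^ m)
      rw [pow_one, pow_succ, mul_pow]
      field_simp
  convert! h3.mul_left (x - x * z) using 2 with n
  have h4 : ∑ k ∈ Finset.range (n + 1), (stirlingB n k : ℂ) * x ^ (2 * n - k) * (x * z) ^ (k + 1) =
      x ^ (2 * n + 1) * stirlingPoly n z := by
    rw [stirlingPoly, Finset.mul_sum]
    refine Finset.sum_congr rfl fun k hk => ?_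
    rw [Finset.mem_range] at hk
    rw [show 2 * n + 1 = (2 * n - k) + (k + 1) by omega, pow_add x (2 * n - k), mul_pow]
    ring
  rw [h4, stirlingPoly_eq n hz, ← hf, hs, mul_pow _ t, ← pow_mul,
    show x - x * z = x * (1 - z) by ring,
    mul_pow]
  ring

end TreeFunction

theorem mainTheorem5 :
    -- the recurrence of the numbers `B(n, k)`, with its initial values
    ((∀ k : ℕ, stirlingB 0 k = if k = 0 then 1 else 0) ∧
      (∀ n : ℕ, stirlingB (n + 1) 0 = stirlingB n 0) ∧
      (∀ n k : ℕ, 1 ≤ n → 1 ≤ k →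
        (stirlingB n k : ℤ) =
          ((k : ℤ) + 1) * stirlingB (n - 1) k
            + (2 * (n : ℤ) - k - 1) * stirlingB (n - 1) (k - 1))) ∧
    -- the identity of formal power series in `y` and `t`
    (∀ (K : Type*) [Field K] [CharZero K],
      treeSeries K = PowerSeries.X * (PowerSeries.exp K).subst (treeSeries K) ∧
      ∀ x : K, x ≠ 0 →
        stirlingSeries x =
          diffSeries x * (treeSeries K).subst (wSeries x)
            * (1 - (treeSeries K).subst (wSeries x))⁻¹) ∧
    -- the identity of numbers, where the series converge
    (∀ x y t : ℂ, ‖y‖ < ‖x‖ →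
      ‖y / x * Complex.exp (-(y / x))‖ * Real.exp ‖(x - y) ^ 2 * t‖ < Real.exp (-1) →
        (Summable fun n : ℕ => treeCoeff ℂ n * wNumber x y t ^ n) ∧
        treeFun (wNumber x y t) = wNumber x y t * Complex.exp (treeFun (wNumber x y t)) ∧
        treeFun (wNumber x y t) ≠ 1 ∧
        HasSum
          (fun n : ℕ =>
            (∑ k ∈ Finset.range (n + 1),
              (stirlingB n k : ℂ) * x ^ (2 * n - k) * y ^ (k + 1)) * (t ^ n / n.factorial))
          ((x - y) * treeFun (wNumber x y t) / (1 - treeFun (wNumber x y t)))) := by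
  refine ⟨⟨stirlingB_zero, stirlingB_succ_zero, fun n k hn hk => ?_⟩, fun K _ _ =>
    ⟨PowerSeries.treeSeries_eq, fun x hx => stirlingSeries_eq hx⟩, fun x y t hxy h => ?_⟩
  · obtain ⟨n, rfl⟩ := Nat.exists_eq_add_of_le' hn
    obtain ⟨k, rfl⟩ := Nat.exists_eq_add_of_le' hk
    rw [Nat.add_sub_cancel, Nat.add_sub_cancel, stirlingB_succ_succ]
    push_cast
    ring
  · have hw : ‖wNumber x y t‖ < Real.exp (-1) := by
      refine lt_of_le_of_lt ?_ h
      rw [wNumber, Complex.exp_add, ← mul_assoc, norm_mul _ (Complex.exp ((x - y) ^ 2 * t))]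
      gcongr
      exact Complex.norm_exp_le_exp_norm _
    refine ⟨by simpa using summable_treeMoment 0 hw, treeFun_eq hw, treeFun_ne_one hw, ?_⟩
    have h1 : 1 - treeFun (wNumber x y t) ≠ 0 := sub_ne_zero.2 (treeFun_ne_one hw).symm
    rw [mul_div_assoc, ← (eq_div_iff h1).2 (treeMoment_one_mul hw)]
    exact hasSum_stirlingB hxy h
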